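/- **Setting.** Let $\mathbf k$ be a field. A filtered cochain complex $X=(X,\partial,\ell)$ is a $\mathbb Z$-graded cochain complex of $\mathbf k$-vector spaces with a function $\ell:X\to\mathbb R\cup\{-\infty\}$ such that $\ell(\lambda a+b)\le\max\{\ell(a),\ell(b)\}$ for $\lambda\neq0$, $\ell(a)=-\infty$ iff $a=0$, $\ell(\partial a)\le\ell(a)$, and all $X^{\le r}=\{\ell\le r\}$ are graded subspaces. A linear map $f$ has shift $\le r$ if $\ell(f(x))\le\ell(x)+r$ for all $x$. In the persistence category $\mathcal C=H^0\mathcal{FK}_{\mathbf k}$, $\hom^r(X,Y)$ is the space of degree $0$ cochain maps of shift $\le r$ modulo the maps $\partial h+h\partial$ with $h$ of degree $-1$ and shift $\le r$; $\mathcal C_0$ has the same objects and the morphisms $\hom^0$. Put $\Sigma^rX=(X,\partial,\ell+r)$ and $TX=X[1]$, with the same $\ell$; $\eta_r:\Sigma^rX\to X$ ($r\ge0$) is induced by the identity. Exact triangles of $\mathcal C_0$ are those isomorphic to $A\xrightarrow{f}B\to\mathrm{Cone}(f)\to TA$ for some filtration-preserving cochain map $f$. An object $K$ is $r$-acyclic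 if $\mathbb 1_K$ is null-homotopic by a homotopy of shift $\le r$; a morphism of $\mathcal C_0$ is an $r$-isomorphism if it embeds in an exact triangle of $\mathcal C_0$ whose third object is $r$-acyclic. For $r\ge 0$, a diagram $A\xrightarrow{\bar u}B\xrightarrow{\bar v}C\xrightarrow{\bar w}\Sigma^{-r}TA$ in $\mathcal C_0$ is a strict exact triangle of weight $r$ if there are an exact triangle $A\xrightarrow{\bar u}B\xrightarrow{v}C'\xrightarrow{w}TA$ of $\mathcal C_0$, an $r$-isomorphism $\phi:C'\to C$ and $\psi:\Sigma^rC\to C'$ with $\phi\psi=\eta_r$, $\phi v=\bar v$, $w\psi=\Sigma^r\bar w$. A cone decomposition of $X$ with linearization $(X_1,\dots,X_n)$ consists of strict exact triangles $X_i\to Y_{i-1}\to Y_i\to\Sigma^{-r_i}TX_i$, $1\le i\le n$, with $Y_0=0$ and $Y_n=X$; its weight is $\sum_ir_i$. For a family $\mathcal F$ of objects, $\delta^{\mathcal F}(X,X')\in[0,\infty]$ is the infimum of the weights of the cone decompositions of $X$ whose linearization has one entry equal to $T^{-1}X'$ and all other entries in $\mathcal F$, and $d^{\mathcal F}(X,X')=\max\{\delta^{\mathcal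 F}(X,X'),\delta^{\mathcal F}(X',X)\}$. A finite barcode is a finite collection, with multiplicities, of bars; each bar has a degree $n\in\mathbb Z$ and is an interval $[a,\infty)$, or a finite interval with endpoints $a\le b$ (length $0$ is allowed). To $[a,\infty)$ in degree $n$ corresponds the complex $E_1(a)$ with one generator, in degree $n$ and at level $a$; to the finite interval with endpoints $a\le b$ in degree $n$ the complex $E_2(a,b)$ with generators $x$ in degree $n$ at level $a$ and $y$ in degree $n-1$ at level $b$, $\partial y=x$. A finite barcode $\mathcal B(X)$ is a barcode of $X$ if $X$ is isomorphic in $\mathcal C_0$ to the direct sum of the complexes of its bars; $\#\mathcal B(X)$ is its number of bars, with multiplicity. The bottleneck distance $d_{\rm bot}(X,Y)\in[0,\infty]$, computed from $\mathcal B(X)$ and $\mathcal B(Y)$, is the infimum of the $\tau\ge0$ for which there are sets of "short" bars $\mathcal B(X)_{\rm short}\subset\mathcal B(X)$, $\mathcal B(Y)_{\rm short}\subset\mathcal B(Y)$, each short bar being finite with endpoints $a\le b$ satisfying $2(b-a)\le\tau$, and a bijection between the remaining bars of $X$ and of $Y$ which preserves the degree, matches infinite bars with infinite bars and finite bars with finite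 bars, and moves each (finite) endpoint by at most $\tau$. **Proposition.** Let $\mathcal F\subset\mathrm{Obj}(\mathcal C)$ be any family containing a zero object of $\mathcal C_0$. Let $X,Y$ be filtered cochain complexes with finite barcodes $\mathcal B(X)$, $\mathcal B(Y)$. Then $$d^{\mathcal F}(X,Y)\ \le\ C_{X,Y}\; d_{\rm bot}(X,Y),\qquad C_{X,Y}=4\min\{\#\mathcal B(X),\#\mathcal B(Y)\}+1 .$$ -/

import Mathlib

open CategoryTheory
open scoped NNReal ENNReal

universe u

/-- A filtered cochain complex `(X, ∂, ℓ)` over the field `k`: a `ℤ`-graded vector space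
`X = ⨁ i, deg i` with a differential `d` of degree `1` and a filtration function
`ℓ : X → ℝ ∪ {-∞}`.  The axiom `ℓ_deg` says that the subspaces `{ℓ ≤ r}` are graded; together with
`iSup_deg` it makes `X` the internal direct sum of the `deg i` (see `FiltCx.isInternal`). -/
structure FiltCx (k : Type u) [Field k] where
  carrier : Type u
  [grp : AddCommGroup carrier]
  [mod : Module k carrier]
  deg : ℤ → Submodule k carrier
  d : carrier →ₗ[k] carrier
  ℓ : carrier → WithBot ℝ
  iSup_deg : ⨆ i, deg i = ⊤
  d_deg : ∀ i x, x ∈ deg i → d x ∈ deg (i + 1)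
  d_d : ∀ x, d (d x) = 0
  ℓ_smul_add : ∀ (c : k) (a b : carrier), c ≠ 0 → ℓ (c • a + b) ≤ max (ℓ a) (ℓ b)
  ℓ_eq_bot : ∀ a, ℓ a = ⊥ ↔ a = 0
  ℓ_d : ∀ a, ℓ (d a) ≤ ℓ a
  ℓ_deg : ∀ (s : Finset ℤ) (x : ℤ → carrier), (∀ i, x i ∈ deg i) →
    ∀ i ∈ s, ℓ (x i) ≤ ℓ (∑ j ∈ s, x j)

namespace FiltCx

noncomputable section

attribute [instance] FiltCx.grp FiltCx.mod

variable {k : Type u} [Field k]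

instance : CoeSort (FiltCx k) (Type u) := ⟨FiltCx.carrier⟩

theorem ℓ_zero (X : FiltCx k) : X.ℓ 0 = ⊥ := (X.ℓ_eq_bot 0).2 rfl

theorem ℓ_add (X : FiltCx k) (a b : X) : X.ℓ (a + b) ≤ max (X.ℓ a) (X.ℓ b) := by
  simpa using X.ℓ_smul_add 1 a b one_ne_zero

theorem ℓ_smul (X : FiltCx k) (c : k) (a : X) : X.ℓ (c • a) ≤ X.ℓ a := by
  by_cases hc : c = 0
  · simp [hc, X.ℓ_zero]
  · simpa [X.ℓ_zero] using X.ℓ_smul_add c a 0 hc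

theorem ℓ_neg (X : FiltCx k) (a : X) : X.ℓ (-a) ≤ X.ℓ a := by
  simpa using X.ℓ_smul (-1) a

theorem isInternal (X : FiltCx k) : DirectSum.IsInternal X.deg := by
  classical
  refine (DirectSum.isInternal_submodule_iff_iSupIndep_and_iSup_eq_top _).2 ⟨?_, X.iSup_deg⟩
  rw [iSupIndep_iff_forall_dfinsupp]
  intro i x v hv
  by_contra hx
  let y : ℤ → X := fun j => if j = i then -(x : X) else ((v.erase i) j : X)
  have hy : ∀ j, y j ∈ X.deg j := by
    intro j
    by_cases hj : j = i
    · subst hj; simp [y]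
    · simp only [y, hj, if_false]; exact Submodule.coe_mem _
  have hsum : ∑ j ∈ insert i (v.erase i).support, y j = 0 := by
    have hi : i ∉ (v.erase i).support := by simp
    rw [Finset.sum_insert hi]
    have h2 : ∑ j ∈ (v.erase i).support, y j = (x : X) := by
      rw [← hv, DFinsupp.lsum_apply_apply, DFinsupp.sumAddHom_apply, DFinsupp.sum]
      refine Finset.sum_congr rfl fun j hj => ?_
      have : j ≠ i := fun h => hi (h ▸ hj)
      simp [y, this]
    rw [h2]; simp [y]
  have h3 := X.ℓ_deg (insert i (v.erase i).support) y hy i (Finset.mem_insert_self _ _)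
  rw [hsum, X.ℓ_zero, le_bot_iff, X.ℓ_eq_bot] at h3
  apply hx
  simpa [y] using h3

/-! ### The persistence category of filtered complexes up to filtered homotopy -/

/-- `hom^{≤ r}(X, Y)` in degree `n`: the linear maps of degree `n` with `ℓ (f x) ≤ ℓ x + r`. -/
def homLE (r : ℝ) (n : ℤ) (X Y : FiltCx k) : Submodule k (X →ₗ[k] Y) where
  carrier := {f | (∀ i x, x ∈ X.deg i → f x ∈ Y.deg (i + n)) ∧ ∀ x, Y.ℓ (f x) ≤ X.ℓ x + (r : ℝ)}
  add_mem' := by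
    rintro f g ⟨hf, hf'⟩ ⟨hg, hg'⟩
    exact ⟨fun i x hx => add_mem (hf i x hx) (hg i x hx),
      fun x => (Y.ℓ_add _ _).trans (max_le (hf' x) (hg' x))⟩
  zero_mem' := ⟨fun i x _ => zero_mem _, fun x => by simp [Y.ℓ_zero]⟩
  smul_mem' := by
    rintro c f ⟨hf, hf'⟩
    exact ⟨fun i x hx => Submodule.smul_mem _ c (hf i x hx), fun x => (Y.ℓ_smul _ _).trans (hf' x)⟩

theorem homLE_comp {r s t : ℝ} {n m p : ℤ} {X Y Z : FiltCx k} {f : X →ₗ[k] Y} {g : Y →ₗ[k] Z}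
    (hf : f ∈ homLE r n X Y) (hg : g ∈ homLE s m Y Z) (hr : r + s ≤ t) (hn : n + m = p) :
    g ∘ₗ f ∈ homLE t p X Z := by
  refine ⟨fun i x hx => ?_, fun x => ?_⟩
  · have := hg.1 _ _ (hf.1 i x hx)
    rwa [add_assoc, hn] at this
  · calc Z.ℓ (g (f x)) ≤ Y.ℓ (f x) + (s : ℝ) := hg.2 _
      _ ≤ (X.ℓ x + (r : ℝ)) + (s : ℝ) := by gcongr; exact hf.2 x
      _ = X.ℓ x + ((r + s : ℝ) : WithBot ℝ) := by rw [add_assoc, WithBot.coe_add]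
      _ ≤ X.ℓ x + (t : ℝ) := by gcongr; exact WithBot.coe_le_coe.2 hr

/-- Degree `0` cocycles of `hom^{≤ r}(X, Y)`: cochain maps `f` with `ℓ(f) ≤ r`. -/
def cocycles (r : ℝ) (X Y : FiltCx k) : Submodule k (X →ₗ[k] Y) where
  carrier := {f | f ∈ homLE r 0 X Y ∧ ∀ x, Y.d (f x) = f (X.d x)}
  add_mem' := by
    rintro f g ⟨hf, hf'⟩ ⟨hg, hg'⟩
    exact ⟨add_mem hf hg, fun x => by simp [hf', hg']⟩
  zero_mem' := ⟨zero_mem _, fun x => by simp⟩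
  smul_mem' := by
    rintro c f ⟨hf, hf'⟩
    exact ⟨Submodule.smul_mem _ c hf, fun x => by simp [hf']⟩

/-- Degree `0` coboundaries of `hom^{≤ r}(X, Y)`: the maps `∂h + h∂` with `h` of degree `-1` and
`ℓ(h) ≤ r`. -/
def coboundaries (r : ℝ) (X Y : FiltCx k) : Submodule k (X →ₗ[k] Y) where
  carrier := {f | ∃ h ∈ homLE r (-1) X Y, ∀ x, f x = Y.d (h x) + h (X.d x)}
  add_mem' := by
    rintro f g ⟨h, hh, hf⟩ ⟨h', hh', hg⟩
    exact ⟨h + h', add_mem hh hh', fun x => by simp [hf, hg]; abel⟩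
  zero_mem' := ⟨0, zero_mem _, fun x => by simp⟩
  smul_mem' := by
    rintro c f ⟨h, hh, hf⟩
    exact ⟨c • h, Submodule.smul_mem _ c hh, fun x => by simp [hf]⟩

/-- `hom^r(X, Y)` in the persistence category `H⁰FK`: the degree `0` cohomology of
`hom^{≤ r}(X, Y)`. -/
abbrev PHom (r : ℝ) (X Y : FiltCx k) : Type u :=
  cocycles r X Y ⧸ (coboundaries r X Y).submoduleOf (cocycles r X Y)

/-- The class of a cochain map `f` with `ℓ(f) ≤ r`. -/
def cls {r : ℝ} {X Y : FiltCx k} (f : X →ₗ[k] Y) (hf : f ∈ cocycles r X Y) : PHom r X Y :=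
  Submodule.Quotient.mk ⟨f, hf⟩

theorem cls_eq_iff {r : ℝ} {X Y : FiltCx k} {f g : X →ₗ[k] Y} (hf : f ∈ cocycles r X Y)
    (hg : g ∈ cocycles r X Y) : cls f hf = cls g hg ↔ f - g ∈ coboundaries r X Y := by
  rw [cls, cls, Submodule.Quotient.eq]; rfl

theorem cls_surj {r : ℝ} {X Y : FiltCx k} (a : PHom r X Y) : ∃ f hf, a = cls f hf := by
  obtain ⟨⟨f, hf⟩, rfl⟩ := Submodule.Quotient.mk_surjective _ a
  exact ⟨f, hf, rfl⟩

theorem comp_mem {r s t : ℝ} (h : r + s = t) {X Y Z : FiltCx k} {f : X →ₗ[k] Y} {g : Y →ₗ[k] Z}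
    (hf : f ∈ cocycles r X Y) (hg : g ∈ cocycles s Y Z) : g ∘ₗ f ∈ cocycles t X Z :=
  ⟨homLE_comp hf.1 hg.1 h.le (by simp), fun x => by simp [hf.2, hg.2]⟩

theorem comp_cob {r s t : ℝ} (h : r + s = t) {X Y Z : FiltCx k} {f f' : X →ₗ[k] Y}
    {g g' : Y →ₗ[k] Z} (hf : f ∈ cocycles r X Y) (hg' : g' ∈ cocycles s Y Z)
    (hff : f - f' ∈ coboundaries r X Y) (hgg : g - g' ∈ coboundaries s Y Z) :
    g ∘ₗ f - g' ∘ₗ f' ∈ coboundaries t X Z := by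
  obtain ⟨p, hp, hp'⟩ := hff
  obtain ⟨q, hq, hq'⟩ := hgg
  refine ⟨q ∘ₗ f + g' ∘ₗ p, add_mem (homLE_comp hf.1 hq h.le (by simp))
    (homLE_comp hp hg'.1 h.le (by simp)), fun x => ?_⟩
  have h1 := hp' x
  have h2 := hq' (f x)
  have h3 := congrArg g' h1
  simp only [LinearMap.sub_apply, map_sub, map_add] at h2 h3
  simp only [LinearMap.sub_apply, LinearMap.comp_apply, LinearMap.add_apply, map_add]
  rw [hg'.2, ← hf.2]
  have e : g (f x) - g' (f' x) = (g (f x) - g' (f x)) + (g' (f x) - g' (f' x)) := by abel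
  rw [e, h2, h3]; abel

/-- Composition `hom^r(X, Y) × hom^s(Y, Z) → hom^{r+s}(X, Z)`. -/
def pcomp {r s t : ℝ} (h : r + s = t) {X Y Z : FiltCx k} (a : PHom r X Y) (b : PHom s Y Z) :
    PHom t X Z :=
  Quotient.liftOn₂' a b (fun f g => cls (g.1 ∘ₗ f.1) (comp_mem h f.2 g.2)) (by
    intro f g f' g' hf hg
    have hf1 : f.1 - f'.1 ∈ coboundaries r X Y := by
      rwa [← Quotient.eq'', Submodule.Quotient.mk''_eq_mk, Submodule.Quotient.mk''_eq_mk,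
        Submodule.Quotient.eq] at hf
    have hg1 : g.1 - g'.1 ∈ coboundaries s Y Z := by
      rwa [← Quotient.eq'', Submodule.Quotient.mk''_eq_mk, Submodule.Quotient.mk''_eq_mk,
        Submodule.Quotient.eq] at hg
    exact (cls_eq_iff _ _).2 (comp_cob h f.2 g'.2 hf1 hg1))

theorem pcomp_cls {r s t : ℝ} (h : r + s = t) {X Y Z : FiltCx k} {f : X →ₗ[k] Y} {g : Y →ₗ[k] Z}
    (hf : f ∈ cocycles r X Y) (hg : g ∈ cocycles s Y Z) :
    pcomp h (cls f hf) (cls g hg) = cls (g ∘ₗ f) (comp_mem h hf hg) := rfl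

theorem id_mem {r : ℝ} (hr : 0 ≤ r) (X : FiltCx k) : LinearMap.id ∈ cocycles r X X := by
  refine ⟨⟨fun i x hx => by simpa using hx, fun x => ?_⟩, fun x => rfl⟩
  calc X.ℓ x = X.ℓ x + ((0 : ℝ) : WithBot ℝ) := by simp
    _ ≤ X.ℓ x + (r : ℝ) := by gcongr; exact WithBot.coe_le_coe.2 hr

/-- The `0`-level `[H⁰FK]₀` of the persistence category `H⁰FK`, as a category on `FiltCx k`. -/
instance : Category (FiltCx k) where
  Hom X Y := PHom 0 X Y
  id X := cls LinearMap.id (id_mem le_rfl X)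
  comp a b := pcomp (add_zero 0) a b
  id_comp a := by obtain ⟨f, hf, rfl⟩ := cls_surj a; rfl
  comp_id a := by obtain ⟨f, hf, rfl⟩ := cls_surj a; rfl
  assoc a b c := by
    obtain ⟨f, hf, rfl⟩ := cls_surj a
    obtain ⟨g, hg, rfl⟩ := cls_surj b
    obtain ⟨h, hh, rfl⟩ := cls_surj c
    rfl

/-- The morphism of `[H⁰FK]₀` represented by a filtered cochain map. -/
def homMk {X Y : FiltCx k} (f : X →ₗ[k] Y) (hf : f ∈ cocycles 0 X Y) : X ⟶ Y := cls f hf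

/-- The persistence structure map `i_{r,s} : hom^r(X, Y) → hom^s(X, Y)`, for `r ≤ s`. -/
def persMap {r s : ℝ} (h : r ≤ s) (X Y : FiltCx k) : PHom r X Y →ₗ[k] PHom s X Y :=
  Submodule.mapQ _ _ (Submodule.inclusion (by
    intro f hf
    exact ⟨⟨hf.1.1, fun x => (hf.1.2 x).trans (by gcongr; exact WithBot.coe_le_coe.2 h)⟩, hf.2⟩)) (by
    rintro ⟨f, hf⟩ ⟨p, hp, hp'⟩
    exact ⟨p, ⟨hp.1, fun x => (hp.2 x).trans (by gcongr; exact WithBot.coe_le_coe.2 h)⟩, hp'⟩)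

/-- `K` is `r`-acyclic: `i_{0,r}(𝟙_K) = 0` in `hom^r(K, K)`. -/
def IsAcyclic (r : ℝ≥0) (K : FiltCx k) : Prop :=
  persMap r.coe_nonneg K K (𝟙 K) = 0

/-! ### Shift functor, translation and cones -/

/-- The shift `Σ^r (X, ∂, ℓ) = (X, ∂, ℓ + r)`. -/
def shift (r : ℝ) (X : FiltCx k) : FiltCx k where
  carrier := X
  deg := X.deg
  d := X.d
  ℓ x := X.ℓ x + (r : ℝ)
  iSup_deg := X.iSup_deg
  d_deg := X.d_deg
  d_d := X.d_d
  ℓ_smul_add c a b hc := by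
    rw [max_add_add_right]; gcongr; exact X.ℓ_smul_add c a b hc
  ℓ_eq_bot a := by simp [WithBot.add_eq_bot, X.ℓ_eq_bot]
  ℓ_d a := by gcongr; exact X.ℓ_d a
  ℓ_deg s x hx i hi := by gcongr; exact X.ℓ_deg s x hx i hi

theorem shift_map_mem {r : ℝ} {X Y : FiltCx k} {f : X →ₗ[k] Y} (hf : f ∈ cocycles 0 X Y) :
    (f : shift r X →ₗ[k] shift r Y) ∈ cocycles 0 (shift r X) (shift r Y) := by
  refine ⟨⟨hf.1.1, fun x => ?_⟩, hf.2⟩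
  have := hf.1.2 x
  simp only [WithBot.coe_zero, add_zero] at this ⊢
  exact add_le_add_left this _

/-- The action of `Σ^r` on the morphisms of `[H⁰FK]₀`. -/
def shiftMap (r : ℝ) {X Y : FiltCx k} (a : X ⟶ Y) : shift r X ⟶ shift r Y :=
  Submodule.mapQ _ ((coboundaries 0 (shift r X) (shift r Y)).submoduleOf
      (cocycles 0 (shift r X) (shift r Y)))
    (Submodule.inclusion (p := cocycles 0 X Y) (p' := cocycles 0 (shift r X) (shift r Y))
      fun _ hf => shift_map_mem hf) (by
    rintro ⟨f, hf⟩ ⟨p, hp, hp'⟩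
    refine ⟨p, ⟨hp.1, fun x => ?_⟩, hp'⟩
    have := hp.2 x
    simp only [WithBot.coe_zero, add_zero] at this ⊢
    exact add_le_add_left this _) a

/-- `η_r^X : Σ^r X ⟶ X`, induced by the identity, for `r ≥ 0`. -/
def eta (r : ℝ≥0) (X : FiltCx k) : shift r X ⟶ X :=
  homMk (X := shift r X) (Y := X) LinearMap.id (by
    refine ⟨⟨fun i x hx => by rw [add_zero]; exact hx, fun x => ?_⟩, fun x => rfl⟩
    change X.ℓ x ≤ X.ℓ x + ((r : ℝ) : WithBot ℝ) + ((0 : ℝ) : WithBot ℝ)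
    rw [WithBot.coe_zero, add_zero]
    nth_rewrite 1 [← add_zero (X.ℓ x)]
    rw [← WithBot.coe_zero]
    gcongr
    exact WithBot.coe_le_coe.2 r.coe_nonneg)

/-- The canonical identification `Σ^r Σ^{-r} X = X`, induced by the identity. -/
def shiftNeg (r : ℝ) (X : FiltCx k) : shift r (shift (-r) X) ⟶ X :=
  homMk (X := shift r (shift (-r) X)) (Y := X) LinearMap.id (by
    refine ⟨⟨fun i x hx => by rw [add_zero]; exact hx, fun x => ?_⟩, fun x => rfl⟩
    change X.ℓ x ≤ X.ℓ x + ((-r : ℝ) : WithBot ℝ) + ((r : ℝ) : WithBot ℝ) +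
      ((0 : ℝ) : WithBot ℝ)
    rw [add_assoc, add_assoc, ← WithBot.coe_add, ← WithBot.coe_add]
    simp)

theorem ℓ_deg_shift (X : FiltCx k) (n : ℤ) (s : Finset ℤ) (x : ℤ → X)
    (hx : ∀ i, x i ∈ X.deg (i + n)) (i : ℤ) (hi : i ∈ s) :
    X.ℓ (x i) ≤ X.ℓ (∑ j ∈ s, x j) := by
  have h := X.ℓ_deg (s.map (Equiv.addRight n).toEmbedding) (fun j => x (j - n))
    (fun j => by simpa using hx (j - n)) (i + n) (by simpa using hi)
  simpa using h

/-- The translate `T X = X[1]`: `(T X)^i = X^{i+1}`, with differential `-∂` and the same filtration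
function. -/
def translate (X : FiltCx k) : FiltCx k where
  carrier := X
  deg i := X.deg (i + 1)
  d := -X.d
  ℓ := X.ℓ
  iSup_deg := (Equiv.addRight (1 : ℤ)).iSup_comp (g := X.deg) |>.trans X.iSup_deg
  d_deg i x hx := neg_mem (X.d_deg _ _ hx)
  d_d x := by simp [X.d_d]
  ℓ_smul_add := X.ℓ_smul_add
  ℓ_eq_bot := X.ℓ_eq_bot
  ℓ_d a := (X.ℓ_neg _).trans (X.ℓ_d a)
  ℓ_deg s x hx i hi := X.ℓ_deg_shift 1 s x hx i hi

/-- The inverse translate `T⁻¹ X = X[-1]`: `(T⁻¹ X)^i = X^{i-1}`, with differential `-∂` and the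
same filtration function. -/
def translateInv (X : FiltCx k) : FiltCx k where
  carrier := X
  deg i := X.deg (i + -1)
  d := -X.d
  ℓ := X.ℓ
  iSup_deg := (Equiv.addRight (-1 : ℤ)).iSup_comp (g := X.deg) |>.trans X.iSup_deg
  d_deg i x hx := by
    have h := X.d_deg _ _ hx
    rw [show i + -1 + 1 = i + 1 + -1 by ring] at h
    exact neg_mem h
  d_d x := by simp [X.d_d]
  ℓ_smul_add := X.ℓ_smul_add
  ℓ_eq_bot := X.ℓ_eq_bot
  ℓ_d a := (X.ℓ_neg _).trans (X.ℓ_d a)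
  ℓ_deg s x hx i hi := X.ℓ_deg_shift (-1) s x hx i hi

theorem translate_map_mem {X Y : FiltCx k} {f : X →ₗ[k] Y} (hf : f ∈ cocycles 0 X Y) :
    (f : translate X →ₗ[k] translate Y) ∈ cocycles 0 (translate X) (translate Y) := by
  refine ⟨⟨fun i x hx => ?_, hf.1.2⟩, fun x => ?_⟩
  · have := hf.1.1 _ x hx
    rw [add_zero] at this ⊢
    exact this
  · exact (congrArg Neg.neg (hf.2 x)).trans (map_neg f (X.d x)).symm

/-- The action of `T` on the morphisms of `[H⁰FK]₀`, induced by `f ↦ f`. -/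
def translateMap {X Y : FiltCx k} (a : X ⟶ Y) : translate X ⟶ translate Y :=
  Submodule.mapQ _ ((coboundaries 0 (translate X) (translate Y)).submoduleOf
      (cocycles 0 (translate X) (translate Y)))
    (Submodule.inclusion (p := cocycles 0 X Y) (p' := cocycles 0 (translate X) (translate Y))
      fun _ hf => translate_map_mem hf) (by
    rintro ⟨f, hf⟩ ⟨p, hp, hp'⟩
    let q : X →ₗ[k] Y := -p
    refine ⟨q, ⟨fun i x hx => ?_, fun x => ?_⟩, fun x => ?_⟩
    · have h : p x ∈ Y.deg (i + 1 + -1) := hp.1 (i + 1) x hx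
      rw [show i + 1 + -1 = i + -1 + 1 by ring] at h
      exact neg_mem h
    · exact (Y.ℓ_neg (p x)).trans (hp.2 x)
    · have h : f x = Y.d (p x) + p (X.d x) := hp' x
      change f x = -Y.d (-p x) + -p (-X.d x)
      rw [map_neg, map_neg, neg_neg, neg_neg, h]) a

/-- The mapping cone of a filtered cochain map: `Y ⊕ X[1]` with differential
`(y, x) ↦ (∂y + f x, -∂x)` and filtration function `max (ℓ y) (ℓ x)`. -/
def cone {X Y : FiltCx k} (f : X →ₗ[k] Y) (hf : f ∈ cocycles 0 X Y) : FiltCx k where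
  carrier := Y × X
  deg i := (Y.deg i).prod (X.deg (i + 1))
  d := (Y.d.comp (LinearMap.fst k Y X) + f.comp (LinearMap.snd k Y X)).prod
    (-(X.d.comp (LinearMap.snd k Y X)))
  ℓ p := max (Y.ℓ p.1) (X.ℓ p.2)
  iSup_deg := by
    rw [eq_top_iff]
    rintro ⟨y, x⟩ -
    have h1 : (⨆ i, Y.deg i) ≤
        (⨆ i, (Y.deg i).prod (X.deg (i + 1))).comap (LinearMap.inl k Y X) := by
      refine iSup_le fun i y hy => ?_
      exact Submodule.mem_iSup_of_mem i ⟨hy, zero_mem _⟩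
    have h2 : (⨆ i, X.deg i) ≤
        (⨆ i, (Y.deg i).prod (X.deg (i + 1))).comap (LinearMap.inr k Y X) := by
      refine iSup_le fun i x hx => ?_
      refine Submodule.mem_iSup_of_mem (i - 1) ⟨zero_mem _, ?_⟩
      simpa using hx
    rw [Y.iSup_deg] at h1
    rw [X.iSup_deg] at h2
    have e : ((y, x) : Y × X) = (y, 0) + (0, x) := by simp
    rw [e]
    exact add_mem (h1 (Submodule.mem_top (x := y))) (h2 (Submodule.mem_top (x := x)))
  d_deg i p hp := by
    have h2 : -X.d p.2 ∈ X.deg (i + 1 + 1) := neg_mem (X.d_deg _ _ hp.2)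
    refine ⟨add_mem (Y.d_deg _ _ hp.1) ?_, h2⟩
    simpa using hf.1.1 _ _ hp.2
  d_d p := by
    ext
    · simp [Y.d_d, hf.2]
    · simp [X.d_d]
  ℓ_smul_add c a b hc :=
    max_le ((Y.ℓ_smul_add c a.1 b.1 hc).trans (max_le_max (le_max_left _ _) (le_max_left _ _)))
      ((X.ℓ_smul_add c a.2 b.2 hc).trans (max_le_max (le_max_right _ _) (le_max_right _ _)))
  ℓ_eq_bot a := by
    rw [max_eq_bot, Y.ℓ_eq_bot, X.ℓ_eq_bot]
    exact (Prod.ext_iff (x := a) (y := (0 : Y × X))).symm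
  ℓ_d p := by
    have h := hf.1.2 p.2
    rw [WithBot.coe_zero, add_zero] at h
    exact max_le ((Y.ℓ_add _ _).trans (max_le_max (Y.ℓ_d _) h))
      (((X.ℓ_neg _).trans (X.ℓ_d _)).trans (le_max_right _ _))
  ℓ_deg s x hx i hi := by
    simp only [Prod.fst_sum, Prod.snd_sum]
    exact max_le_max (Y.ℓ_deg s (fun i => (x i).1) (fun i => (hx i).1) i hi)
      (X.ℓ_deg_shift 1 s (fun i => (x i).2) (fun i => (hx i).2) i hi)

/-- The inclusion `Y ⟶ Cone(f)`. -/
def coneIncl {X Y : FiltCx k} (f : X →ₗ[k] Y) (hf : f ∈ cocycles 0 X Y) : Y ⟶ cone f hf :=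
  homMk (X := Y) (Y := cone f hf) (LinearMap.inl k Y X) (by
    refine ⟨⟨fun i y hy => ⟨by rw [add_zero]; exact hy, zero_mem _⟩, fun y => ?_⟩, fun y => ?_⟩
    · change max (Y.ℓ y) (X.ℓ 0) ≤ _
      simp [X.ℓ_zero]
    · change ((Y.d y + f 0, -X.d 0) : Y × X) = (Y.d y, 0)
      simp)

/-- The projection `Cone(f) ⟶ T X`. -/
def coneProj {X Y : FiltCx k} (f : X →ₗ[k] Y) (hf : f ∈ cocycles 0 X Y) :
    cone f hf ⟶ translate X :=
  homMk (X := cone f hf) (Y := translate X) (LinearMap.snd k Y X) (by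
    refine ⟨⟨fun i p hp => by rw [add_zero]; exact hp.2, fun p => ?_⟩, fun p => ?_⟩
    · change X.ℓ p.2 ≤ max (Y.ℓ p.1) (X.ℓ p.2) + ((0 : ℝ) : WithBot ℝ)
      simp
    · rfl)

/-! ### Exact triangles, strict exact triangles and their weights -/

/-- A triangle `A ⟶ B ⟶ C ⟶ TA` of `[H⁰FK]₀` is exact if it is isomorphic to the triangle
`A' ⟶ B' ⟶ Cone(f) ⟶ TA'` of some filtered cochain map `f : A' → B'`. -/
def IsExact {A B C : FiltCx k} (a : A ⟶ B) (b : B ⟶ C) (c : C ⟶ translate A) : Prop :=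
  ∃ (A' B' : FiltCx k) (f : A' →ₗ[k] B') (hf : f ∈ cocycles 0 A' B')
    (α : A ≅ A') (β : B ≅ B') (γ : C ≅ cone f hf),
    a ≫ β.hom = α.hom ≫ homMk f hf ∧ b ≫ γ.hom = β.hom ≫ coneIncl f hf ∧
      c ≫ translateMap α.hom = γ.hom ≫ coneProj f hf

/-- `φ` is an `r`-isomorphism: it embeds into an exact triangle of `[H⁰FK]₀` whose third object
is `r`-acyclic. -/
def IsRIso (r : ℝ≥0) {A B : FiltCx k} (φ : A ⟶ B) : Prop :=
  ∃ (K : FiltCx k) (b : B ⟶ K) (c : K ⟶ translate A), IsExact φ b c ∧ IsAcyclic r K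

/-- The diagram `A ⟶ B ⟶ C ⟶ Σ^{-r} T A` is a strict exact triangle of weight `r`. -/
def IsStrictExact (r : ℝ≥0) {A B C : FiltCx k} (a : A ⟶ B) (b : B ⟶ C)
    (c : C ⟶ shift (-r) (translate A)) : Prop :=
  ∃ (C' : FiltCx k) (v : B ⟶ C') (w : C' ⟶ translate A) (φ : C' ⟶ C) (ψ : shift r C ⟶ C'),
    IsExact a v w ∧ IsRIso r φ ∧ ψ ≫ φ = eta r C ∧ v ≫ φ = b ∧
      ψ ≫ w = shiftMap r c ≫ shiftNeg r (translate A)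

/-! ### Finite direct sums and the zero complex -/

/-- The direct sum of finitely many filtered complexes, filtered by `ℓ x = max_j ℓ (x_j)`. -/
def dsum {n : ℕ} (E : Fin n → FiltCx k) : FiltCx k where
  carrier := ∀ j, E j
  deg i := Submodule.pi Set.univ fun j => (E j).deg i
  d := LinearMap.pi fun j => (E j).d ∘ₗ LinearMap.proj j
  ℓ x := Finset.univ.sup fun j => (E j).ℓ (x j)
  iSup_deg := by
    classical
    rw [eq_top_iff]
    rintro x -
    rw [← Finset.univ_sum_single x]
    refine sum_mem fun j _ => ?_
    have h : (⨆ i, (E j).deg i) ≤ (⨆ i, Submodule.pi Set.univ fun j => (E j).deg i).comap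
        (LinearMap.single k (fun j => (E j).carrier) j) := by
      refine iSup_le fun i y hy => Submodule.mem_iSup_of_mem i ?_
      rintro j' -
      by_cases hj : j' = j
      · subst hj; simpa using hy
      · simp [hj]
    rw [(E j).iSup_deg] at h
    exact h (Submodule.mem_top (x := x j))
  d_deg i x hx := fun j _ => (E j).d_deg i (x j) (hx j trivial)
  d_d x := by ext j; simp [(E j).d_d]
  ℓ_smul_add c a b hc := Finset.sup_le fun j hj =>
    ((E j).ℓ_smul_add c (a j) (b j) hc).trans (max_le_max
      (Finset.le_sup (f := fun j => (E j).ℓ (a j)) hj)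
      (Finset.le_sup (f := fun j => (E j).ℓ (b j)) hj))
  ℓ_eq_bot a := by
    rw [Finset.sup_eq_bot_iff]
    simp only [Finset.mem_univ, true_imp_iff, (E _).ℓ_eq_bot]
    exact funext_iff.symm
  ℓ_d a := Finset.sup_mono_fun fun j _ => (E j).ℓ_d (a j)
  ℓ_deg s x hx i hi := by
    refine Finset.sup_mono_fun fun j _ => ?_
    rw [Finset.sum_apply]
    exact (E j).ℓ_deg s (fun i => x i j) (fun i => hx i j trivial) i hi

variable (k) in
/-- The zero complex. -/
def zero : FiltCx k := dsum (n := 0) Fin.elim0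

/-! ### Cone decompositions and the fragmentation pseudo-metric -/

/-- `ConeDec X L w`: the object `X` has an iterated cone decomposition
`X₁ ⟶ 0 ⟶ Y₁ ⟶ Σ^{-r₁} T X₁`, …, `Xₙ ⟶ Yₙ₋₁ ⟶ X ⟶ Σ^{-rₙ} T Xₙ` into strict exact triangles,
with linearization `L = [X₁, …, Xₙ]` and weight `w = r₁ + ⋯ + rₙ`. -/
inductive ConeDec : FiltCx k → List (FiltCx k) → ℝ≥0 → Prop
  | nil : ConeDec (zero k) [] 0
  | snoc {Y Y' X : FiltCx k} {L : List (FiltCx k)} {w r : ℝ≥0}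
      (a : X ⟶ Y) (b : Y ⟶ Y') (c : Y' ⟶ shift (-r) (translate X))
      (hD : ConeDec Y L w) (hΔ : IsStrictExact r a b c) : ConeDec Y' (L ++ [X]) (w + r)

/-- `δ^F(X, X')`: the infimum of the weights of the cone decompositions of `X` with linearization
`(F₁, …, T⁻¹X', …, Fₘ)`, all `Fᵢ ∈ F`. -/
def fragDelta (F : Set (FiltCx k)) (X X' : FiltCx k) : ℝ≥0∞ :=
  sInf {e | ∃ (w : ℝ≥0) (L₁ L₂ : List (FiltCx k)), (∀ A ∈ L₁, A ∈ F) ∧ (∀ A ∈ L₂, A ∈ F) ∧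
    ConeDec X (L₁ ++ [translateInv X'] ++ L₂) w ∧ e = w}

/-- The fragmentation pseudo-metric `d^F`. -/
def fragDist (F : Set (FiltCx k)) (X X' : FiltCx k) : ℝ≥0∞ :=
  max (fragDelta F X X') (fragDelta F X' X)

end

end FiltCx

/-! ### Barcodes and the bottleneck distance -/

/-- A bar in degree `n`: a half-infinite interval `[a, ∞)` or a finite interval `[a, b)`, where the
length `b - a` may be zero. -/
inductive Bar
  | ray (n : ℤ) (a : ℝ)
  | seg (n : ℤ) (a b : ℝ) (h : a ≤ b)

/-- A finite barcode: finitely many bars, listed with multiplicity. -/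
structure Barcode where
  card : ℕ
  bar : Fin card → Bar

namespace FiltCx

noncomputable section

variable {k : Type u} [Field k]

open Classical in
/-- The filtration function of a one-dimensional space whose nonzero elements have level `a`. -/
def lev (a : ℝ) (x : k) : WithBot ℝ := if x = 0 then ⊥ else (a : WithBot ℝ)

theorem lev_zero (a : ℝ) : lev a (0 : k) = ⊥ := by simp [lev]

theorem lev_eq_bot (a : ℝ) (x : k) : lev a x = ⊥ ↔ x = 0 := by
  by_cases h : x = 0 <;> simp [lev, h]

theorem lev_smul_add (a : ℝ) (c x y : k) : lev a (c * x + y) ≤ max (lev a x) (lev a y) := by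
  by_cases hx : x = 0 <;> by_cases hy : y = 0 <;> by_cases h : c * x + y = 0 <;>
    simp_all [lev]

theorem lev_sum (a : ℝ) (n : ℤ) (s : Finset ℤ) (x : ℤ → k) (hx : ∀ i, i ≠ n → x i = 0) (i : ℤ)
    (hi : i ∈ s) : lev a (x i) ≤ lev a (∑ j ∈ s, x j) := by
  by_cases h : i = n
  · subst h
    rw [Finset.sum_eq_single_of_mem i hi fun j _ hj => hx j hj]
  · rw [hx i h, lev_zero]; exact bot_le

variable (k) in
/-- `E₁(a)`: one generator in degree `n`, at level `a`. -/
def E₁ (n : ℤ) (a : ℝ) : FiltCx k where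
  carrier := k
  deg i :=
    { carrier := {x | i ≠ n → x = 0}
      add_mem' := fun hx hy h => by rw [hx h, hy h, add_zero]
      zero_mem' := fun _ => rfl
      smul_mem' := fun c x hx h => by rw [hx h, smul_zero] }
  d := 0
  ℓ := lev a
  iSup_deg := by
    rw [eq_top_iff]
    exact fun x _ => Submodule.mem_iSup_of_mem n fun h => (h rfl).elim
  d_deg i x hx := zero_mem _
  d_d x := rfl
  ℓ_smul_add c x y _ := lev_smul_add a c x y
  ℓ_eq_bot := lev_eq_bot a
  ℓ_d x := by simp [lev_zero]
  ℓ_deg s x hx i hi := lev_sum a n s x (fun i => hx i) i hi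

variable (k) in
/-- `E₂(a, b)`: a generator `x` in degree `n` at level `a` and a generator `y` in degree `n - 1` at
level `b ≥ a`, with `∂y = x`; the pair `(p, q)` stands for `p x + q y`. -/
def E₂ (n : ℤ) (a b : ℝ) (hab : a ≤ b) : FiltCx k where
  carrier := k × k
  deg i :=
    { carrier := {p | (i ≠ n → p.1 = 0) ∧ (i ≠ n - 1 → p.2 = 0)}
      add_mem' := fun {p q} hp hq =>
        ⟨fun h => by simp [hp.1 h, hq.1 h], fun h => by simp [hp.2 h, hq.2 h]⟩
      zero_mem' := ⟨fun _ => rfl, fun _ => rfl⟩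
      smul_mem' := fun c p hp => ⟨fun h => by simp [hp.1 h], fun h => by simp [hp.2 h]⟩ }
  d := (LinearMap.snd k k k).prod 0
  ℓ p := max (lev a p.1) (lev b p.2)
  iSup_deg := by
    rw [eq_top_iff]
    rintro ⟨x, y⟩ -
    have e : ((x, y) : k × k) = (x, 0) + (0, y) := by simp
    rw [e]
    refine add_mem (Submodule.mem_iSup_of_mem n ⟨fun h => (h rfl).elim, fun _ => rfl⟩)
      (Submodule.mem_iSup_of_mem (n - 1) ⟨fun _ => rfl, fun h => (h rfl).elim⟩)
  d_deg i p hp := ⟨fun h => hp.2 fun h' => h (by omega), fun _ => rfl⟩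
  d_d p := rfl
  ℓ_smul_add c p q _ :=
    max_le ((lev_smul_add a c p.1 q.1).trans (max_le_max (le_max_left _ _) (le_max_left _ _)))
      ((lev_smul_add b c p.2 q.2).trans (max_le_max (le_max_right _ _) (le_max_right _ _)))
  ℓ_eq_bot p := by
    rw [max_eq_bot, lev_eq_bot, lev_eq_bot, Prod.ext_iff]; rfl
  ℓ_d p := by
    refine max_le (le_trans ?_ (le_max_right _ _)) ?_
    · change lev a p.2 ≤ lev b p.2
      by_cases h : p.2 = 0 <;> simp [lev, h, hab]
    · change lev b (0 : k) ≤ _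
      rw [lev_zero]; exact bot_le
  ℓ_deg s x hx i hi := by
    simp only [Prod.fst_sum, Prod.snd_sum]
    exact max_le_max (lev_sum a n s (fun i => (x i).1) (fun i => (hx i).1) i hi)
      (lev_sum b (n - 1) s (fun i => (x i).2) (fun i => (hx i).2) i hi)

variable (k) in
/-- The elementary complex of a bar. -/
def ofBar : Bar → FiltCx k
  | .ray n a => E₁ k n a
  | .seg n a b h => E₂ k n a b h

/-- `B` is a (finite) barcode of `X`: in `[H⁰FK]₀` there is an isomorphism
`X ≅ ⨁ E₁(a) ⊕ ⨁ E₂(a, b)`, the sums running over the bars of `B`. -/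
def HasBarcode (X : FiltCx k) (B : Barcode) : Prop :=
  Nonempty (X ≅ dsum fun j => ofBar k (B.bar j))

end

end FiltCx

namespace Bar

/-- A bar that may be left unmatched at `τ`: a finite one with `2 (b - a) ≤ τ`. -/
def IsShort (τ : ℝ≥0) : Bar → Prop
  | ray _ _ => False
  | seg _ a b _ => 2 * (b - a) ≤ τ

/-- Two bars that may be matched at `τ`: bars of the same degree, both infinite or both finite,
whose corresponding endpoints differ by at most `τ`. -/
def IsClose (τ : ℝ≥0) : Bar → Bar → Prop
  | ray n a, ray m c => n = m ∧ |a - c| ≤ τ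
  | seg n a b _, seg m c d _ => n = m ∧ max |a - c| |b - d| ≤ τ
  | _, _ => False

end Bar

namespace Barcode

/-- There is a `τ`-matching between `B` and `B'`: subsets of short bars whose complements are
matched by a bijection `σ`. -/
def IsMatched (τ : ℝ≥0) (B B' : Barcode) : Prop :=
  ∃ (S : Set (Fin B.card)) (S' : Set (Fin B'.card)) (σ : ↥Sᶜ ≃ ↥S'ᶜ),
    (∀ i ∈ S, (B.bar i).IsShort τ) ∧ (∀ j ∈ S', (B'.bar j).IsShort τ) ∧
      ∀ i : ↥Sᶜ, (B.bar i).IsClose τ (B'.bar (σ i))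

/-- The bottleneck distance; it is `∞` if there is no matching. -/
noncomputable def bottleneck (B B' : Barcode) : ℝ≥0∞ :=
  sInf {e | ∃ τ : ℝ≥0, IsMatched τ B B' ∧ e = τ}

end Barcode

namespace FiltCx

variable {k : Type u} [Field k]

/-! A matching at level `τ` is treated as a whole rather than bar by bar, so that two triangles are
enough. Let `X'` and `Y'` be the sums of elementary complexes representing `X` and `Y`. The
bijection gives cochain maps `f : Y' → X'` and `g : X' → Y'` of shift at most `s = τ`, zero on the
short bars. They are mutually inverse up to the homotopies `p`, `q` that contract the short bars,
and these have shift at most `τ`. Moreover `f q = 0 = p f`, since homotopies and matching maps live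
on complementary sets of bars.

By this compatibility `p`, `q` and `g` assemble into a contraction of the cone of `f : Σ^s Y' → X'`
(`isAcyclic_cone`). Its shift is `r = 2s`: seen as a map into `Σ^s Y'`, `g` has shift `2s`. So `f`
is an `r`-isomorphism, with right inverse `g` up to `η_r`.

The decomposition of `X` in `fragDelta_le` has linearization `(Z, T⁻¹Y)`, with `Z` a zero object in
the family. The first triangle builds the cone of `η_s : T⁻¹Σ^s Y → T⁻¹Y` from zero; this cone is
`s`-acyclic, so the weight is `s`. The second attaches `T⁻¹Y`: the rotated cone triangle of `η_s`
produces `Σ^s Y`, and the `r`-isomorphism replaces it by `X` at weight `r`.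

The total is `s + r = 3τ`, at most the required multiple of `τ` when both barcodes are nonempty. If
one is empty, every bar is short, so `s = 0` and `r = τ` are allowed and the weight is `τ`. Thus the
number of bars matters only through being zero or not. -/

theorem add_coe_le_add_coe {r s : ℝ} (h : r ≤ s) (a : WithBot ℝ) : a + (r : ℝ) ≤ a + (s : ℝ) := by
  gcongr
  exact WithBot.coe_le_coe.2 h

theorem le_add_coe {r : ℝ} (h : 0 ≤ r) (a : WithBot ℝ) : a ≤ a + (r : ℝ) := by
  simpa using add_coe_le_add_coe h a

/-! ### Calculus of representatives -/

theorem homMk_surj {X Y : FiltCx k} (a : X ⟶ Y) : ∃ f hf, a = homMk f hf := cls_surj a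

theorem homMk_eq_iff {X Y : FiltCx k} {f g : X →ₗ[k] Y} (hf : f ∈ cocycles 0 X Y)
    (hg : g ∈ cocycles 0 X Y) : homMk f hf = homMk g hg ↔ f - g ∈ coboundaries 0 X Y :=
  cls_eq_iff hf hg

theorem shiftMap_id (r : ℝ) (X : FiltCx k) : shiftMap r (𝟙 X) = 𝟙 (shift r X) := rfl

theorem shiftMap_comp (r : ℝ) {X Y Z : FiltCx k} (a : X ⟶ Y) (b : Y ⟶ Z) :
    shiftMap r (a ≫ b) = shiftMap r a ≫ shiftMap r b := by
  obtain ⟨f, hf, rfl⟩ := homMk_surj a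
  obtain ⟨g, hg, rfl⟩ := homMk_surj b
  rfl

theorem translateMap_id (X : FiltCx k) : translateMap (𝟙 X) = 𝟙 (translate X) := rfl

theorem translateMap_comp {X Y Z : FiltCx k} (a : X ⟶ Y) (b : Y ⟶ Z) :
    translateMap (a ≫ b) = translateMap a ≫ translateMap b := by
  obtain ⟨f, hf, rfl⟩ := homMk_surj a
  obtain ⟨g, hg, rfl⟩ := homMk_surj b
  rfl

/-- The isomorphism `Σ^r X ≅ Σ^r Y` induced by an isomorphism `X ≅ Y`. -/
noncomputable def shiftIso (r : ℝ) {X Y : FiltCx k} (e : X ≅ Y) : shift r X ≅ shift r Y where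
  hom := shiftMap r e.hom
  inv := shiftMap r e.inv
  hom_inv_id := by rw [← shiftMap_comp, e.hom_inv_id, shiftMap_id]
  inv_hom_id := by rw [← shiftMap_comp, e.inv_hom_id, shiftMap_id]

theorem eta_naturality (r : ℝ≥0) {X Y : FiltCx k} (a : X ⟶ Y) :
    shiftMap r a ≫ eta r Y = eta r X ≫ a := by
  obtain ⟨f, hf, rfl⟩ := homMk_surj a
  rfl

/-- Morphisms `Σ^r X ⟶ A` are adjoint to morphisms `X ⟶ Σ^{-r} A`. -/
theorem exists_shiftMap_comp_shiftNeg (r : ℝ) {X A : FiltCx k} (m : shift r X ⟶ A) :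
    ∃ c : X ⟶ shift (-r) A, m = shiftMap r c ≫ shiftNeg r A := by
  obtain ⟨f, hf, rfl⟩ := homMk_surj m
  refine ⟨homMk (X := X) (Y := shift (-r) A) f ⟨⟨hf.1.1, fun x => ?_⟩, hf.2⟩, rfl⟩
  have h : A.ℓ (f x) ≤ X.ℓ x + (r : ℝ) + ((0 : ℝ) : WithBot ℝ) := hf.1.2 x
  change A.ℓ (f x) + ((-r : ℝ) : WithBot ℝ) ≤ X.ℓ x + ((0 : ℝ) : WithBot ℝ)
  calc A.ℓ (f x) + ((-r : ℝ) : WithBot ℝ)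
      ≤ X.ℓ x + (r : ℝ) + ((0 : ℝ) : WithBot ℝ) + ((-r : ℝ) : WithBot ℝ) := by gcongr
    _ = X.ℓ x + ((0 : ℝ) : WithBot ℝ) := by
      rw [add_assoc, add_assoc, ← WithBot.coe_add, ← WithBot.coe_add]
      congr 2
      ring

/-! ### Acyclic objects and zero objects -/

theorem isAcyclic_iff {r : ℝ≥0} {K : FiltCx k} :
    IsAcyclic r K ↔ ∃ h ∈ homLE r (-1) K K, ∀ x, x = K.d (h x) + h (K.d x) := by
  have e : persMap r.coe_nonneg K K (𝟙 K) = cls LinearMap.id (id_mem r.coe_nonneg K) := rfl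
  rw [IsAcyclic, e, cls, Submodule.Quotient.mk_eq_zero]
  rfl

theorem isZero_of_subsingleton (X : FiltCx k) [Subsingleton X] : Limits.IsZero X where
  unique_to Y := ⟨⟨⟨homMk 0 (zero_mem _)⟩, fun a => by
    obtain ⟨f, hf, rfl⟩ := homMk_surj a
    congr 1
    exact Subsingleton.elim f 0⟩⟩
  unique_from Y := ⟨⟨⟨homMk 0 (zero_mem _)⟩, fun a => by
    obtain ⟨f, hf, rfl⟩ := homMk_surj a
    congr 1
    exact LinearMap.ext fun x => Subsingleton.elim (f x) 0⟩⟩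

instance : Subsingleton (zero k) := inferInstanceAs (Subsingleton (∀ _ : Fin 0, _))

/-- The cone of `f : A → B` is `r`-acyclic if `f` has a homotopy inverse of shift at most `r`,
with homotopies that commute with `f`. -/
theorem isAcyclic_cone {r : ℝ≥0} {A B : FiltCx k} {f : A →ₗ[k] B} (hf : f ∈ cocycles 0 A B)
    {g : B →ₗ[k] A} (hg : g ∈ cocycles r B A)
    {p : B →ₗ[k] B} (hp : p ∈ homLE r (-1) B B) {q : A →ₗ[k] A} (hq : q ∈ homLE r (-1) A A)
    (hp' : ∀ b, b = f (g b) + (B.d (p b) + p (B.d b)))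
    (hq' : ∀ a, a = g (f a) + (A.d (q a) + q (A.d a)))
    (hpq : ∀ a, f (q a) = p (f a)) : IsAcyclic r (cone f hf) := by
  -- The contraction is `(b, a) ↦ (p b, g b - q a)`. In the identity to be checked, `p` and `q` give
  -- the diagonal terms, `g` being a cochain map removes one off-diagonal term, and `f q = p f`
  -- removes the other.
  refine isAcyclic_iff.2 ⟨(p.comp (LinearMap.fst k B A)).prod
    (g.comp (LinearMap.fst k B A) - q.comp (LinearMap.snd k B A)), ⟨?_, ?_⟩, ?_⟩
  · rintro i ⟨b, a⟩ ⟨hb, ha⟩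
    have h1 : g b ∈ A.deg (i + 0) := hg.1.1 i b hb
    have h2 : q a ∈ A.deg (i + 1 + -1) := hq.1 (i + 1) a ha
    refine ⟨hp.1 i b hb, ?_⟩
    change g b - q a ∈ A.deg (i + -1 + 1)
    rw [show i + 1 + -1 = i by ring] at h2
    rw [show i + -1 + 1 = i by ring]
    exact sub_mem (by simpa using h1) h2
  · rintro ⟨b, a⟩
    change max (B.ℓ (p b)) (A.ℓ (g b - q a)) ≤ max (B.ℓ b) (A.ℓ a) + ((r : ℝ) : WithBot ℝ)
    rw [← max_add_add_right, sub_eq_add_neg]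
    exact max_le ((hp.2 b).trans (le_max_left _ _)) ((A.ℓ_add _ _).trans
      (max_le_max (hg.1.2 b) ((A.ℓ_neg _).trans (hq.2 a))))
  · rintro ⟨b, a⟩
    refine Prod.ext ?_ ?_
    · change b = B.d (p b) + f (g b - q a) + p (B.d b + f a)
      rw [map_sub, map_add, hpq]
      nth_rewrite 1 [hp' b]
      abel
    · change a = -A.d (g b - q a) + (g (B.d b + f a) - q (-A.d a))
      rw [map_sub, map_add, map_neg, hg.2]
      nth_rewrite 1 [hq' a]
      abel

/-- A cochain map which is homotopic to the identity by a homotopy of shift at most `r`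
represents `η_r`. -/
theorem homMk_eq_eta {r : ℝ≥0} {X : FiltCx k} {f : X →ₗ[k] X}
    (hf : (f : shift r X →ₗ[k] X) ∈ cocycles 0 (shift r X) X)
    {p : X →ₗ[k] X} (hp : p ∈ homLE r (-1) X X)
    (h : ∀ x, x = f x + (X.d (p x) + p (X.d x))) :
    homMk (X := shift r X) (Y := X) f hf = eta r X := by
  refine Eq.symm ((homMk_eq_iff (X := shift r X) (Y := X) (f := LinearMap.id) (g := f) _ hf).2
    ⟨(p : shift r X →ₗ[k] X), ⟨hp.1, fun x => ?_⟩, fun x => ?_⟩)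
  · exact (hp.2 x).trans (le_add_coe le_rfl _)
  · exact sub_eq_iff_eq_add'.2 (h x)

/-! ### Criteria for `r`-isomorphisms and strict exact triangles -/

/-- A morphism isomorphic to one that is represented by a cochain map with `r`-acyclic cone is an
`r`-isomorphism. -/
theorem isRIso_of_isAcyclic_cone {r : ℝ≥0} {A B A' B' : FiltCx k} {φ : A ⟶ B} (α : A ≅ A')
    (β : B ≅ B') {f : A' →ₗ[k] B'} (hf : f ∈ cocycles 0 A' B') (h : φ ≫ β.hom = α.hom ≫ homMk f hf)
    (hK : IsAcyclic r (cone f hf)) : IsRIso r φ := by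
  refine ⟨cone f hf, β.hom ≫ coneIncl f hf, coneProj f hf ≫ translateMap α.inv,
    ⟨A', B', f, hf, α, β, Iso.refl _, h, Category.comp_id _, ?_⟩, hK⟩
  rw [Category.assoc, ← translateMap_comp, α.inv_hom_id, translateMap_id]
  exact (Category.comp_id _).trans (Category.id_comp _).symm

/-- An `r`-acyclic object is the third object of a strict exact triangle of weight `r` on a zero
object and the zero complex. -/
theorem exists_isStrictExact_of_isAcyclic {r : ℝ≥0} {K Z : FiltCx k} (hK : IsAcyclic r K)
    (hZ : Limits.IsZero Z) : ∃ (a : Z ⟶ zero k) (b : zero k ⟶ K)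
      (c : K ⟶ shift (-r) (translate Z)), IsStrictExact r a b c := by
  have h0 : Limits.IsZero (zero k) := isZero_of_subsingleton _
  have h00 : (0 : zero k →ₗ[k] zero k) ∈ cocycles 0 (zero k) (zero k) := zero_mem _
  have hC : Limits.IsZero (cone _ h00) :=
    haveI : Subsingleton (cone _ h00) := inferInstanceAs (Subsingleton (zero k × zero k))
    isZero_of_subsingleton _
  let w : zero k ⟶ translate Z := h0.to_ _
  let φ : zero k ⟶ K := h0.to_ _
  let ψ : shift r K ⟶ zero k := h0.from_ _
  obtain ⟨c, hc⟩ := exists_shiftMap_comp_shiftNeg r (ψ ≫ w)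
  obtain ⟨p, hp, hp'⟩ := isAcyclic_iff.1 hK
  refine ⟨h0.from_ Z, φ, c, zero k, 𝟙 _, w, φ, ψ, ?_, ?_, ?_, Category.id_comp _, hc⟩
  · exact ⟨zero k, zero k, 0, h00, hZ.iso h0, Iso.refl _, h0.iso hC, h0.eq_of_tgt _ _,
      h0.eq_of_src _ _, h0.eq_of_src _ _⟩
  -- The source of `φ` is the zero complex, so the contraction `p` of `K` alone contracts the cone.
  · refine isRIso_of_isAcyclic_cone (Iso.refl _) (Iso.refl _) (f := 0) (zero_mem _)
      (h0.eq_of_src _ _) (isAcyclic_cone _ (g := 0) (zero_mem _) hp (q := 0) (zero_mem _)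
        (fun b => by simpa using hp' b) (fun a => Subsingleton.elim _ _) (fun a => by simp))
  -- `ψ ≫ φ` factors through the zero complex, and the contraction of `K` says exactly that `η_r`
  -- vanishes as well.
  · have e : ψ ≫ φ = homMk (X := shift r K) (Y := K) 0 (zero_mem _) := by
      rw [h0.eq_of_tgt ψ (homMk 0 (zero_mem _)), h0.eq_of_src φ (homMk 0 (zero_mem _))]
      rfl
    rw [e]
    exact homMk_eq_eta _ hp fun x => (hp' x).trans (zero_add _).symm

/-- Mostly applied with `r = 0`: a bound for a morphism of shift `0` carries a literal summand `(0 :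
ℝ)` cast to `WithBot ℝ`. -/
theorem ℓ_le_add_of_le {r : ℝ} {a b : WithBot ℝ} (h : a ≤ b) (hr : 0 ≤ r) : a ≤ b + (r : ℝ) :=
  h.trans (le_add_coe hr _)

/-! ### The cone of `η_s` and the rotation of cone triangles -/

theorem shiftTranslateInv_mem (s : ℝ≥0) (Y : FiltCx k) :
    (LinearMap.id : Y →ₗ[k] Y) ∈ cocycles 0 (translateInv (shift s Y)) (translateInv Y) := by
  refine ⟨⟨fun i x hx => ?_, fun x => ?_⟩, fun x => rfl⟩
  · rw [add_zero]
    exact hx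
  · exact ℓ_le_add_of_le (le_add_coe s.coe_nonneg (Y.ℓ x)) le_rfl

/-- The cone of `η_s : T⁻¹ Σ^s Y → T⁻¹ Y`. -/
noncomputable def etaCone (s : ℝ≥0) (Y : FiltCx k) : FiltCx k :=
  cone (X := translateInv (shift s Y)) (Y := translateInv Y) LinearMap.id
    (shiftTranslateInv_mem s Y)

/-- The underlying map is the identity, whose strict inverse only raises levels by `s`; no
homotopies are needed. -/
theorem isAcyclic_etaCone (s : ℝ≥0) (Y : FiltCx k) : IsAcyclic s (etaCone s Y) := by
  have h : ∀ x : Y, x = x + (-Y.d 0 + 0) := fun x => by simp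
  refine isAcyclic_cone (A := translateInv (shift s Y)) (B := translateInv Y) _
    (g := (LinearMap.id : Y →ₗ[k] Y)) ⟨⟨fun i x hx => ?_, fun x => le_rfl⟩, fun x => rfl⟩
    (zero_mem _) (zero_mem _) h h (fun x => rfl)
  rw [add_zero]
  exact hx

theorem inl_mem_cocycles {X Y : FiltCx k} {f : X →ₗ[k] Y} (hf : f ∈ cocycles 0 X Y) :
    (LinearMap.inl k Y X : Y →ₗ[k] cone f hf) ∈ cocycles 0 Y (cone f hf) := by
  refine ⟨⟨fun i y hy => ⟨by rw [add_zero]; exact hy, zero_mem _⟩, fun y => ?_⟩, fun y => ?_⟩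
  · change max (Y.ℓ y) (X.ℓ 0) ≤ _
    simp [X.ℓ_zero]
  · change ((Y.d y + f 0, -X.d 0) : Y × X) = (Y.d y, 0)
    simp

/-- The cone of the inclusion `Y → Cone(f)` is isomorphic to `TX`. -/
noncomputable def coneInclCone {X Y : FiltCx k} {f : X →ₗ[k] Y} (hf : f ∈ cocycles 0 X Y) :
    translate X ≅ cone _ (inl_mem_cocycles hf) where
  hom := homMk (X := translate X) (Y := cone _ (inl_mem_cocycles hf))
    -- The component `-f x` cancels the term `f x` that the differential of the inner cone adds to
    -- the first copy of `Y`.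
    ((LinearMap.inr k Y X).prod (-f) : X →ₗ[k] (Y × X) × Y) (by
      refine ⟨⟨fun i x hx => ?_, fun x => ?_⟩, fun x => ?_⟩
      · have h := hf.1.1 (i + 1) x hx
        rw [add_zero] at h ⊢
        exact ⟨⟨zero_mem _, hx⟩, neg_mem h⟩
      · change max (max (Y.ℓ 0) (X.ℓ x)) (Y.ℓ (-f x)) ≤ X.ℓ x + ((0 : ℝ) : WithBot ℝ)
        refine max_le (max_le ?_ (le_add_coe le_rfl _)) ((Y.ℓ_neg _).trans (hf.1.2 x))
        rw [Y.ℓ_zero]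
        exact bot_le
      · change (((Y.d 0 + f x) + -f x, -X.d x + 0), -Y.d (-f x)) = ((0, -X.d x), -f (-X.d x))
        simp only [map_zero, map_neg, zero_add, add_zero, add_neg_cancel, neg_neg, hf.2 x])
  inv := homMk (X := cone _ (inl_mem_cocycles hf)) (Y := translate X)
    (LinearMap.snd k Y X ∘ₗ LinearMap.fst k (Y × X) Y : (Y × X) × Y →ₗ[k] X) (by
      refine ⟨⟨fun i x hx => ?_, fun x => ?_⟩, fun x => ?_⟩
      · rw [add_zero]
        exact hx.1.2
      · exact ℓ_le_add_of_le ((le_max_right _ _).trans (le_max_left _ _)) le_rfl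
      · change -X.d x.1.2 = -X.d x.1.2 + 0
        simp)
  hom_inv_id := rfl
  inv_hom_id := by
    refine Eq.symm ((homMk_eq_iff (X := cone _ (inl_mem_cocycles hf))
      (Y := cone _ (inl_mem_cocycles hf)) (f := LinearMap.id) _ _).2
      -- The two copies of `Y` cancel each other: the homotopy `((y, x), z) ↦ ((0, 0), y)` moves the
      -- first copy to the second without raising levels.
      ⟨(LinearMap.inr k (Y × X) Y ∘ₗ LinearMap.fst k Y X ∘ₗ LinearMap.fst k (Y × X) Y :
        (Y × X) × Y →ₗ[k] (Y × X) × Y), ⟨fun i x hx => ?_, fun x => ?_⟩, fun x => ?_⟩)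
    · have h : x.1.1 ∈ Y.deg i := hx.1.1
      refine ⟨zero_mem _, ?_⟩
      change x.1.1 ∈ Y.deg (i + -1 + 1)
      rwa [show i + -1 + 1 = i by ring]
    · refine ℓ_le_add_of_le ?_ le_rfl
      change max (max (Y.ℓ 0) (X.ℓ 0)) (Y.ℓ x.1.1) ≤ max (max (Y.ℓ x.1.1) (X.ℓ x.1.2)) (Y.ℓ x.2)
      rw [Y.ℓ_zero, X.ℓ_zero]
      exact max_le (by simp) ((le_max_left _ _).trans (le_max_left _ _))
    · obtain ⟨⟨y, x⟩, z⟩ := x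
      change (((y, x), z) - ((0, x), -f x) : (Y × X) × Y) =
        ((Y.d 0 + f 0 + y, -X.d 0 + 0), -Y.d y) + ((0, 0), Y.d y + f x + z)
      simp only [map_zero, Prod.mk_sub_mk, Prod.mk_add_mk, Prod.mk.injEq]
      refine ⟨⟨by abel, by abel⟩, by abel⟩

/-- The canonical isomorphism `X ≅ T T⁻¹ X`, induced by the identity. -/
noncomputable def translateTranslateInvIso (X : FiltCx k) : X ≅ translate (translateInv X) where
  hom := homMk (X := X) (Y := translate (translateInv X)) LinearMap.id (by
    refine ⟨⟨fun i x hx => ?_, fun x => le_add_coe le_rfl _⟩, fun x => neg_neg (X.d x)⟩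
    change x ∈ X.deg (i + 0 + 1 + -1)
    rwa [show i + 0 + 1 + -1 = i by ring])
  inv := homMk (X := translate (translateInv X)) (Y := X) LinearMap.id (by
    refine ⟨⟨fun i x hx => ?_, fun x => le_add_coe le_rfl _⟩, fun x => (neg_neg (X.d x)).symm⟩
    have h : x ∈ X.deg (i + 1 + -1) := hx
    rwa [show i + 1 + -1 = i + 0 by ring] at h)
  hom_inv_id := rfl
  inv_hom_id := rfl

/-- A rotated exact triangle `Y ⟶ Cone(f) ⟶ W ⟶ TY`, where `W ≅ TX`. -/
theorem exists_isExact_rotate {X Y W : FiltCx k} {f : X →ₗ[k] Y} (hf : f ∈ cocycles 0 X Y)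
    (e : W ≅ translate X) :
    ∃ (u : Y ⟶ cone f hf) (v : cone f hf ⟶ W) (w : W ⟶ translate Y), IsExact u v w := by
  let γ : W ≅ cone _ (inl_mem_cocycles hf) := e ≪≫ coneInclCone hf
  refine ⟨homMk _ (inl_mem_cocycles hf), coneIncl _ (inl_mem_cocycles hf) ≫ γ.inv,
    γ.hom ≫ coneProj _ (inl_mem_cocycles hf), _, _, _, inl_mem_cocycles hf, Iso.refl _,
    Iso.refl _, γ, ?_, ?_, ?_⟩
  · exact (Category.comp_id _).trans (Category.id_comp _).symm
  · rw [Category.assoc, γ.inv_hom_id, Category.comp_id]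
    exact (Category.id_comp _).symm
  · exact Category.comp_id _

/-! ### Bounding the fragmentation distance -/

/-- If `X'` and `Y'` represent `X` and `Y` in `[H⁰FK]₀` and there are a cochain map `Y' → X'` of
shift at most `s` and a homotopy inverse of it, such that the cone of the map `Σ^s Y' → X'` is
`r`-acyclic, then `δ(X, Y) ≤ s + r`. -/
theorem fragDelta_le {F : Set (FiltCx k)} (hF : ∃ Z ∈ F, Limits.IsZero Z) {X Y X' Y' : FiltCx k}
    (eX : X ≅ X') (eY : Y ≅ Y') {s r : ℝ≥0} {t : ℝ} (hst : s + t ≤ r)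
    {f : Y' →ₗ[k] X'} (hf : f ∈ cocycles s Y' X')
    {g : X' →ₗ[k] Y'} (hg : g ∈ cocycles t X' Y')
    {p : X' →ₗ[k] X'} (hp : p ∈ homLE r (-1) X' X') {q : Y' →ₗ[k] Y'} (hq : q ∈ homLE r (-1) Y' Y')
    (hp' : ∀ x, x = f (g x) + (X'.d (p x) + p (X'.d x)))
    (hq' : ∀ y, y = g (f y) + (Y'.d (q y) + q (Y'.d y)))
    (hpq : ∀ y, f (q y) = p (f y)) : fragDelta F X Y ≤ (s + r : ℝ≥0) := by
  obtain ⟨Z, hZF, hZ⟩ := hF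
  obtain ⟨a₁, b₁, c₁, h₁⟩ := exists_isStrictExact_of_isAcyclic (isAcyclic_etaCone s Y) hZ
  obtain ⟨u, v, w, h₂⟩ := exists_isExact_rotate (shiftTranslateInv_mem s Y)
    (translateTranslateInvIso (shift s Y))
  have hf₀ : (f : shift s Y' →ₗ[k] X') ∈ cocycles 0 (shift s Y') X' :=
    ⟨⟨hf.1.1, fun y => ℓ_le_add_of_le (hf.1.2 y) le_rfl⟩, hf.2⟩
  -- Shifting the target by `s` raises the shift of `g` from `t` to `s + t`; hence the hypothesis `s
  -- + t ≤ r`.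
  have hgr : (g : X' →ₗ[k] shift s Y') ∈ cocycles r X' (shift s Y') := by
    refine ⟨⟨hg.1.1, fun x => ?_⟩, hg.2⟩
    change Y'.ℓ (g x) + ((s : ℝ) : WithBot ℝ) ≤ X'.ℓ x + ((r : ℝ) : WithBot ℝ)
    calc Y'.ℓ (g x) + ((s : ℝ) : WithBot ℝ)
        ≤ X'.ℓ x + (t : WithBot ℝ) + ((s : ℝ) : WithBot ℝ) := by gcongr; exact hg.1.2 x
      _ = X'.ℓ x + ((s + t : ℝ) : WithBot ℝ) := by
        rw [add_assoc, ← WithBot.coe_add, add_comm t]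
      _ ≤ _ := add_coe_le_add_coe hst _
  have hg₀ : (g : shift r X' →ₗ[k] shift s Y') ∈ cocycles 0 (shift r X') (shift s Y') :=
    ⟨⟨hg.1.1, fun x => ℓ_le_add_of_le (hgr.1.2 x) le_rfl⟩, hg.2⟩
  have hqs : (q : shift s Y' →ₗ[k] shift s Y') ∈ homLE r (-1) (shift s Y') (shift s Y') := by
    refine ⟨hq.1, fun y => ?_⟩
    change Y'.ℓ (q y) + ((s : ℝ) : WithBot ℝ) ≤
      Y'.ℓ y + ((s : ℝ) : WithBot ℝ) + ((r : ℝ) : WithBot ℝ)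
    rw [add_right_comm]
    gcongr
    exact hq.2 y
  let φ₀ : shift s Y' ⟶ X' := homMk (X := shift s Y') (Y := X') f hf₀
  let ψ₀ : shift r X' ⟶ shift s Y' := homMk (X := shift r X') (Y := shift s Y') g hg₀
  have hη : ψ₀ ≫ φ₀ = eta r X' := homMk_eq_eta _ hp hp'
  let φ : shift s Y ⟶ X := (shiftIso s eY).hom ≫ φ₀ ≫ eX.inv
  let ψ : shift r X ⟶ shift s Y := shiftMap r eX.hom ≫ ψ₀ ≫ (shiftIso s eY).inv
  -- The last arrow of the strict triangle is forced: it is the adjoint of `ψ ≫ w`.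
  obtain ⟨c, hc⟩ := exists_shiftMap_comp_shiftNeg r (ψ ≫ w)
  have h₃ : IsStrictExact r u (v ≫ φ) c := by
    refine ⟨shift s Y, v, w, φ, ψ, h₂, ?_, ?_, rfl, hc⟩
    · refine isRIso_of_isAcyclic_cone (shiftIso s eY) eX hf₀ (by simp [φ, φ₀])
        (isAcyclic_cone hf₀ hgr hp hqs hp' hq' hpq)
    · have h := eta_naturality r eX.hom
      calc ψ ≫ φ = shiftMap r eX.hom ≫ (ψ₀ ≫ φ₀) ≫ eX.inv := by simp [φ, ψ]
        _ = eta r X := by rw [hη, reassoc_of% h, eX.hom_inv_id, Category.comp_id]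
  -- The zero object `Z` is spent on the acyclic cone, so `T⁻¹Y` is the last entry and nothing
  -- follows it.
  refine sInf_le ⟨s + r, [Z], [], by simpa using hZF, by simp, ?_, rfl⟩
  simpa using (ConeDec.nil.snoc a₁ b₁ c₁ h₁).snoc u (v ≫ φ) c h₃

end FiltCx

namespace FiltCx

variable {k : Type u} [Field k]

/-! ### Maps between direct sums of elementary complexes -/

theorem pi_mem_homLE {r : ℝ} {m : ℤ} {n : ℕ} {X : FiltCx k} {E : Fin n → FiltCx k}
    {f : ∀ i, X →ₗ[k] E i} (hf : ∀ i, f i ∈ homLE r m X (E i)) :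
    (LinearMap.pi f : X →ₗ[k] dsum E) ∈ homLE r m X (dsum E) :=
  ⟨fun i x hx j _ => (hf j).1 i x hx, fun x =>
    Finset.sup_le (s := Finset.univ) (f := fun j => (E j).ℓ (f j x)) fun j _ => (hf j).2 x⟩

theorem pi_mem_cocycles {r : ℝ} {n : ℕ} {X : FiltCx k} {E : Fin n → FiltCx k}
    {f : ∀ i, X →ₗ[k] E i} (hf : ∀ i, f i ∈ cocycles r X (E i)) :
    (LinearMap.pi f : X →ₗ[k] dsum E) ∈ cocycles r X (dsum E) :=
  ⟨pi_mem_homLE fun i => (hf i).1, fun x => funext fun j => (hf j).2 x⟩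

theorem proj_mem_cocycles {n : ℕ} (E : Fin n → FiltCx k) (j : Fin n) :
    (LinearMap.proj j : dsum E →ₗ[k] E j) ∈ cocycles 0 (dsum E) (E j) :=
  ⟨⟨fun i x hx => by rw [add_zero]; exact hx j trivial, fun x => ℓ_le_add_of_le
    (Finset.le_sup (f := fun j => (E j).ℓ (x j)) (Finset.mem_univ j)) le_rfl⟩, fun x => rfl⟩

theorem lev_le {a c τ : ℝ} (h : c ≤ a + τ) (x : k) : lev c x ≤ lev a x + (τ : WithBot ℝ) := by
  by_cases hx : x = 0
  · simp [hx, lev_zero]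
  · simp only [lev, hx, if_false]
    exact WithBot.coe_le_coe.2 h

variable (k) in
/-- The map between the elementary complexes of two bars of the same kind which matches their
generators, and `0` for two bars of different kinds. -/
noncomputable def barMap : (B B' : Bar) → (ofBar k B →ₗ[k] ofBar k B')
  | .ray _ _, .ray _ _ => (LinearMap.id : k →ₗ[k] k)
  | .seg _ _ _ _, .seg _ _ _ _ => (LinearMap.id : k × k →ₗ[k] k × k)
  | .ray _ _, .seg _ _ _ _ => 0
  | .seg _ _ _ _, .ray _ _ => 0

theorem barMap_mem_cocycles {τ : ℝ≥0} {B B' : Bar} (h : B.IsClose τ B') :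
    barMap k B B' ∈ cocycles τ (ofBar k B) (ofBar k B') := by
  match B, B', h with
  | .ray n a, .ray _ c, ⟨rfl, h⟩ =>
    refine ⟨⟨fun i x hx => by rw [add_zero]; exact hx, fun x => ?_⟩, fun x => rfl⟩
    exact lev_le (k := k) (by linarith [(abs_le.1 h).1]) x
  | .seg n a b _, .seg _ c d _, ⟨rfl, h⟩ =>
    refine ⟨⟨fun i x hx => by rw [add_zero]; exact hx, fun x => ?_⟩, fun x => rfl⟩
    obtain ⟨h1, h2⟩ := max_le_iff.1 h
    change max (lev c x.1) (lev d x.2) ≤ max (lev a x.1) (lev b x.2) + ((τ : ℝ) : WithBot ℝ)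
    rw [← max_add_add_right]
    exact max_le_max (lev_le (by linarith [(abs_le.1 h1).1]) _)
      (lev_le (by linarith [(abs_le.1 h2).1]) _)

theorem barMap_barMap {τ : ℝ≥0} {B B' : Bar} (h : B.IsClose τ B') (x : ofBar k B) :
    barMap k B' B (barMap k B B' x) = x := by
  match B, B', h with
  | .ray _ _, .ray _ _, _ => rfl
  | .seg _ _ _ _, .seg _ _ _ _, _ => rfl

variable (k) in
/-- The contraction `x ↦ y` of the elementary complex of a finite bar. -/
noncomputable def barHtpy : (B : Bar) → (ofBar k B →ₗ[k] ofBar k B)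
  | .ray _ _ => 0
  | .seg _ _ _ _ => (LinearMap.inr k k k ∘ₗ LinearMap.fst k k k : k × k →ₗ[k] k × k)

/-- The contraction sends the generator at level `a` to the one at level `b`, so it costs `b - a`.
This is at most `2 (b - a) ≤ τ`; the factor `2` leaves room to spare. -/
theorem barHtpy_mem_homLE {τ : ℝ≥0} {B : Bar} (h : B.IsShort τ) :
    barHtpy k B ∈ homLE τ (-1) (ofBar k B) (ofBar k B) := by
  match B, h with
  | .seg n a b hab, h =>
    have h' : 2 * (b - a) ≤ τ := h
    refine ⟨fun i x hx => ⟨fun _ => rfl, fun hi => hx.1 fun e => hi (by rw [e]; rfl)⟩, fun x => ?_⟩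
    change max (lev a (0 : k)) (lev b x.1) ≤
      max (lev a x.1) (lev b x.2) + ((τ : ℝ) : WithBot ℝ)
    rw [lev_zero, max_eq_right bot_le]
    exact (lev_le (by linarith) _).trans (add_le_add_left (le_max_left _ _) _)

theorem barHtpy_spec {τ : ℝ≥0} {B : Bar} (h : B.IsShort τ) (x : ofBar k B) :
    x = (ofBar k B).d (barHtpy k B x) + barHtpy k B ((ofBar k B).d x) := by
  match B, h with
  | .seg n a b hab, _ =>
    have e : ∀ y : k × k, y = (y.1, 0) + (0, y.2) := fun y => by simp
    exact e x

/-! ### Chain maps and contractions attached to a matching -/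

variable (k) in
/-- The direct sum of the elementary complexes of finitely many bars. -/
noncomputable abbrev barSum {n : ℕ} (B : Fin n → Bar) : FiltCx k := dsum fun j => ofBar k (B j)

open Classical in
variable (k) in
/-- The map from the sum of the bars `B` to that of the bars `B'` which is zero over the bars in
`S` and otherwise given by the matching `ρ`. -/
noncomputable def matchMap {m n : ℕ} (B : Fin m → Bar) (B' : Fin n → Bar) (S : Set (Fin n))
    (ρ : ↥Sᶜ → Fin m) : barSum k B →ₗ[k] barSum k B' :=
  LinearMap.pi fun i => if h : i ∈ S then 0 else
    barMap k (B (ρ ⟨i, h⟩)) (B' i) ∘ₗ LinearMap.proj (ρ ⟨i, h⟩)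

open Classical in
variable (k) in
/-- The contraction of the bars in `S`. -/
noncomputable def matchHtpy {n : ℕ} (B : Fin n → Bar) (S : Set (Fin n)) :
    barSum k B →ₗ[k] barSum k B :=
  LinearMap.pi fun i => if i ∈ S then barHtpy k (B i) ∘ₗ LinearMap.proj i else 0

section

variable {m n : ℕ} {B : Fin m → Bar} {B' : Fin n → Bar} {S : Set (Fin n)} {ρ : ↥Sᶜ → Fin m}

theorem matchMap_apply_mem {i : Fin n} (h : i ∈ S) (x : barSum k B) :
    matchMap k B B' S ρ x i = 0 :=
  LinearMap.congr_fun (dif_pos h) x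

theorem matchMap_apply_notMem {i : Fin n} (h : i ∉ S) (x : barSum k B) :
    matchMap k B B' S ρ x i = barMap k (B (ρ ⟨i, h⟩)) (B' i) (x (ρ ⟨i, h⟩)) :=
  LinearMap.congr_fun (dif_neg h) x

theorem matchHtpy_apply_mem {i : Fin n} (h : i ∈ S) (x : barSum k B') :
    matchHtpy k B' S x i = barHtpy k (B' i) (x i) :=
  LinearMap.congr_fun (if_pos h) x

theorem matchHtpy_apply_notMem {i : Fin n} (h : i ∉ S) (x : barSum k B') :
    matchHtpy k B' S x i = 0 :=
  LinearMap.congr_fun (if_neg h) x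

theorem matchMap_mem_cocycles {τ : ℝ≥0} (h : ∀ i : ↥Sᶜ, (B (ρ i)).IsClose τ (B' i)) :
    matchMap k B B' S ρ ∈ cocycles τ (barSum k B) (barSum k B') := by
  refine pi_mem_cocycles fun i => ?_
  split_ifs with hi
  · exact zero_mem _
  · exact comp_mem (zero_add _) (proj_mem_cocycles _ _) (barMap_mem_cocycles (h ⟨i, hi⟩))

theorem matchHtpy_mem_homLE {τ r : ℝ≥0} (hr : τ ≤ r) (h : ∀ i ∈ S, (B' i).IsShort τ) :
    matchHtpy k B' S ∈ homLE r (-1) (barSum k B') (barSum k B') := by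
  refine pi_mem_homLE fun i => ?_
  split_ifs with hi
  · exact homLE_comp (proj_mem_cocycles _ _).1 (barHtpy_mem_homLE (h i hi))
      ((zero_add _).trans_le (NNReal.coe_le_coe.2 hr)) (zero_add _)
  · exact zero_mem _

/-- The contraction takes values in the short bars, while the matching map reads only the matched
ones. With `matchHtpy_matchMap` this makes both sides of the compatibility condition `f q = p f`
vanish. -/
theorem matchMap_matchHtpy {S' : Set (Fin m)} (σ : ↥Sᶜ ≃ ↥S'ᶜ) (x : barSum k B) :
    matchMap k B B' S (fun i => (σ i).1) (matchHtpy k B S' x) = 0 := by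
  funext i
  by_cases hi : i ∈ S
  · exact matchMap_apply_mem hi _
  · rw [matchMap_apply_notMem hi, matchHtpy_apply_notMem (σ ⟨i, hi⟩).2, map_zero]
    rfl

theorem matchHtpy_matchMap (x : barSum k B) :
    matchHtpy k B' S (matchMap k B B' S ρ x) = 0 := by
  funext i
  by_cases hi : i ∈ S
  · rw [matchHtpy_apply_mem hi, matchMap_apply_mem hi, map_zero]
    rfl
  · exact matchHtpy_apply_notMem hi _

/-- The identity splits bar by bar: over a short bar the round trip is zero and the contraction
supplies the identity; over a matched bar the round trip is the identity and the contraction is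
zero. -/
theorem matchMap_homotopy {S' : Set (Fin m)} {τ τ' : ℝ≥0} (σ : ↥Sᶜ ≃ ↥S'ᶜ)
    (hS : ∀ i ∈ S, (B' i).IsShort τ) (hσ : ∀ i : ↥Sᶜ, (B' i).IsClose τ' (B (σ i)))
    (x : barSum k B') :
    x = matchMap k B B' S (fun i => (σ i).1) (matchMap k B' B S' (fun j => (σ.symm j).1) x) +
      ((barSum k B').d (matchHtpy k B' S x) + matchHtpy k B' S ((barSum k B').d x)) := by
  funext i
  change x i = matchMap k B B' S _ _ i +
    ((ofBar k (B' i)).d (matchHtpy k B' S x i) + matchHtpy k B' S ((barSum k B').d x) i)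
  by_cases hi : i ∈ S
  · rw [matchMap_apply_mem hi, matchHtpy_apply_mem hi, matchHtpy_apply_mem hi, zero_add]
    exact barHtpy_spec (hS i hi) (x i)
  -- The index reached by the round trip is `σ.symm (σ i)`, equal to `i` only propositionally, and
  -- the type of `x l` depends on `l`; generalizing over `l` avoids a transport.
  · have e : ∀ l, l = i → barMap k (B (σ ⟨i, hi⟩)) (B' i)
        (barMap k (B' l) (B (σ ⟨i, hi⟩)) (x l)) = x i := by
      rintro l rfl
      exact barMap_barMap (hσ ⟨l, hi⟩) (x l)
    rw [matchMap_apply_notMem hi, matchHtpy_apply_notMem hi, matchHtpy_apply_notMem hi,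
      matchMap_apply_notMem (σ ⟨i, hi⟩).2, map_zero, add_zero, add_zero]
    exact (e _ (by simp)).symm

end

end FiltCx

/-! ### Symmetry of matchings and the final estimate -/

theorem Bar.IsClose.symm {τ : ℝ≥0} {B B' : Bar} (h : B.IsClose τ B') : B'.IsClose τ B := by
  match B, B', h with
  | .ray _ _, .ray _ _, ⟨rfl, h⟩ => exact ⟨rfl, by rwa [abs_sub_comm]⟩
  | .seg _ a b _, .seg _ c d _, ⟨rfl, h⟩ =>
    exact ⟨rfl, by rwa [abs_sub_comm c, abs_sub_comm d]⟩

theorem Barcode.IsMatched.symm {τ : ℝ≥0} {B B' : Barcode} (h : B.IsMatched τ B') :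
    B'.IsMatched τ B := by
  obtain ⟨S, S', σ, hS, hS', hσ⟩ := h
  exact ⟨S', S, σ.symm, hS', hS, fun j => by simpa using (hσ (σ.symm j)).symm⟩

namespace FiltCx

variable {k : Type u} [Field k]

/-- The estimate of `δ^F` for a matching whose short bars have length at most
`τ / 2` and whose matched bars are at distance at most `s`. -/
theorem fragDelta_le_of_matching {F : Set (FiltCx k)} (hF : ∃ Z ∈ F, Limits.IsZero Z)
    {X Y : FiltCx k} {BX BY : Barcode} (hX : X.HasBarcode BX) (hY : Y.HasBarcode BY)
    {S : Set (Fin BX.card)} {S' : Set (Fin BY.card)} (σ : ↥Sᶜ ≃ ↥S'ᶜ) {s τ r : ℝ≥0}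
    (hS : ∀ i ∈ S, (BX.bar i).IsShort τ) (hS' : ∀ j ∈ S', (BY.bar j).IsShort τ)
    (hσ : ∀ i : ↥Sᶜ, (BX.bar i).IsClose s (BY.bar (σ i))) (hs : s + s ≤ r) (hτ : τ ≤ r) :
    fragDelta F X Y ≤ (s + r : ℝ≥0) := by
  obtain ⟨eX⟩ := hX
  obtain ⟨eY⟩ := hY
  have hσ' : ∀ j : ↥S'ᶜ, (BY.bar j).IsClose s (BX.bar (σ.symm j)) := fun j => by
    simpa using (hσ (σ.symm j)).symm
  refine fragDelta_le hF eX eY (t := s) (by exact_mod_cast hs)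
    (matchMap_mem_cocycles (S := S) (ρ := fun i => (σ i).1) fun i => (hσ i).symm)
    (matchMap_mem_cocycles (S := S') (ρ := fun j => (σ.symm j).1) fun j => (hσ' j).symm)
    (matchHtpy_mem_homLE hτ hS) (matchHtpy_mem_homLE hτ hS')
    (matchMap_homotopy σ hS hσ) (matchMap_homotopy σ.symm hS' hσ') fun y => ?_
  rw [matchMap_matchHtpy, matchHtpy_matchMap]

/-- A matching costs `3τ` in general, which exceeds the allowed bound only when a barcode is empty;
that case is treated separately and costs `τ`. -/
theorem fragDelta_le_of_isMatched {F : Set (FiltCx k)} (hF : ∃ Z ∈ F, Limits.IsZero Z)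
    {X Y : FiltCx k} {BX BY : Barcode} (hX : X.HasBarcode BX) (hY : Y.HasBarcode BY) {τ : ℝ≥0}
    (h : BX.IsMatched τ BY) :
    fragDelta F X Y ≤ ((4 * min BX.card BY.card + 1 : ℕ) : ℝ≥0∞) * τ := by
  obtain ⟨S, S', σ, hS, hS', hσ⟩ := h
  rcases Nat.eq_zero_or_pos (min BX.card BY.card) with h0 | h0
  -- With an empty barcode on either side no bars are matched, so closeness holds vacuously with `s
  -- = 0`, and only the contraction of short bars contributes.
  · have hE : IsEmpty ↥Sᶜ := by
      rcases (Nat.min_eq_zero_iff.1 h0) with h | h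
      · exact ⟨fun i => (Fin.cast h i.1).elim0⟩
      · exact ⟨fun i => (Fin.cast h (σ i).1).elim0⟩
    refine (fragDelta_le_of_matching hF hX hY σ (s := 0) (r := τ) hS hS' (fun i => hE.elim i)
      (by simp) le_rfl).trans ?_
    simp [h0]
  -- Here `s = τ` and `r = 2τ`, and `3 ≤ 4 * min + 1` because the minimum is at least `1`.
  · refine (fragDelta_le_of_matching hF hX hY σ (r := τ + τ) hS hS' hσ le_rfl
      le_self_add).trans ?_
    have e : ((τ + (τ + τ) : ℝ≥0) : ℝ≥0∞) = ((3 : ℕ) : ℝ≥0∞) * τ := by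
      push_cast
      ring
    rw [e]
    gcongr
    omega

end FiltCx

theorem mainTheorem6 {k : Type u} [Field k] (F : Set (FiltCx k))
    (hF : ∃ Z ∈ F, Limits.IsZero Z) (X Y : FiltCx k) (BX BY : Barcode)
    (hX : X.HasBarcode BX) (hY : Y.HasBarcode BY) :
    FiltCx.fragDist F X Y ≤
      ((4 * min BX.card BY.card + 1 : ℕ) : ENNReal) * BX.bottleneck BY := by
  -- The constant is nonzero and finite, so it passes inside the infimum even if there is no
  -- matching and the distance is `∞`; each matching is then treated separately.
  rw [Barcode.bottleneck, sInf_eq_iInf', ENNReal.mul_iInf_of_ne (by simp)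
    (ENNReal.natCast_ne_top _)]
  refine le_iInf ?_
  rintro ⟨_, τ, h, rfl⟩
  refine max_le (FiltCx.fragDelta_le_of_isMatched hF hX hY h) ?_
  rw [min_comm]
  exact FiltCx.fragDelta_le_of_isMatched hF hY hX h.symm
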